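/- Let $H$ be a separable complex Hilbert space, let $-\infty<a_1<a_3<+\infty$, and let $A_1,A_3$ be (possibly unbounded) selfadjoint operators in $H$. For $k=1,3$ let $H_{k,+}$ be $D(A_k)$ with the inner product $(A_kf,A_kg)+(f,g)$, let $H_{k,-}\supset H$ be the corresponding negative space (the continuous antilinear functionals on $H_{k,+}$, with $f\in H$ acting as $g\mapsto (f,g)$), and let $\tilde A_k:H\to H_{k,-}$ be the adjoint of $A_k:H_{k,+}\to H$, which extends $A_k$. Put $I_1=(-\infty,a_1)$ and $I_3=(a_3,\infty)$. The maximal operator $L_k$ in $L^2(H,I_k)$ is $L_ku=iu'+\tilde A_ku$, its domain being the set of all $u\in L^2(H,I_k)$ with $iu'+\tilde A_ku\in L^2(H,I_k)$, where $u'$ is the weak derivative with values in $H_{k,-}$. The minimal operator $L_{k0}$ is the closure of the restriction of $L_k$ to the $C^\infty$ functions $I_k\to H_{k,+}$ with compact support in $I_k$. Then every selfadjoint extension of the minimal operator $L_{10}\oplus 0\oplus L_{30}$ in the Hilbert space $L^2(H,(-\infty,a_1))\oplus 0\oplus L^2(H,(a_3,\infty))$ has empty point spectrum (that is, no eigenvalues).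 Likewise, for every unitary operator $W_1:H\to H$, the operator $L_{W_1}$, which is the restriction of $L_1\oplus 0\oplus L_3$ to those $u=(u_1,0,u_3)$ in its domain that satisfy the boundary condition $u_3(a_3)=W_1u_1(a_1)$ (boundary values being taken from representatives of $u_1,u_3$ that are continuous with values in $H$ up to the boundary point), has empty point spectrum: $\sigma_p(L_{W_1})=\emptyset$. -/

import Mathlib

open MeasureTheory Set
open scoped ContDiff ComplexConjugate

noncomputable section

namespace MultipointOperator

variable {H : Type*} [NormedAddCommGroup H] [InnerProductSpace ℂ H]

/-! ### The positive and the negative space of an operator -/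

/-- The positive space `H₊` of an operator `A` in `H`: the domain of `A`, with the inner product
`(f, g)₊ = (A f, A g) + (f, g)`. It is realized as the graph of `A` in the Hilbert space `H ⊕ H`,
the vector `f` of the domain being the point `(f, A f)` of the graph. -/
abbrev PosSpace (A : H →ₗ.[ℂ] H) : Submodule ℂ (WithLp 2 (H × H)) :=
  A.graph.comap (WithLp.linearEquiv 2 ℂ (H × H)).toLinearMap

namespace PosSpace

variable (A : H →ₗ.[ℂ] H)

/-- The inclusion `H₊ → H`. -/
def incl : PosSpace A →L[ℂ] H := (WithLp.fstL 2 ℂ H H).comp (PosSpace A).subtypeL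

/-- The operator `A` as a bounded map `H₊ → H`. -/
def op : PosSpace A →L[ℂ] H := (WithLp.sndL 2 ℂ H H).comp (PosSpace A).subtypeL

/-- A vector of the domain of `A` as an element of `H₊`. -/
def ofDomain (f : A.domain) : PosSpace A := ⟨WithLp.toLp 2 ((f : H), A f), A.mem_graph f⟩

lemma incl_ofDomain (f : A.domain) : incl A (ofDomain A f) = f := rfl

lemma op_ofDomain (f : A.domain) : op A (ofDomain A f) = A f := rfl

lemma exists_ofDomain (p : PosSpace A) : ∃ f : A.domain, ofDomain A f = p := by
  obtain ⟨⟨x⟩, hx⟩ := p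
  obtain ⟨f, h1, h2⟩ := A.mem_graph_iff.1 hx
  refine ⟨f, Subtype.ext ?_⟩
  exact congrArg (WithLp.toLp 2) (Prod.ext h1 h2)

lemma inner_ofDomain (f g : A.domain) :
    inner ℂ (ofDomain A f) (ofDomain A g) = inner ℂ (A f) (A g) + inner ℂ (f : H) (g : H) := by
  rw [add_comm]
  rfl

end PosSpace

/-- The negative space `H₋`: the continuous antilinear functionals on `H₊`, with the dual norm
`‖f‖₋ = sup {|f g| : ‖g‖₊ ≤ 1}`. -/
def NegSpace (A : H →ₗ.[ℂ] H) : Type _ := PosSpace A →L⋆[ℂ] ℂ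

namespace NegSpace

variable (A : H →ₗ.[ℂ] H)

instance : NormedAddCommGroup (NegSpace A) :=
  inferInstanceAs (NormedAddCommGroup (PosSpace A →L⋆[ℂ] ℂ))

instance : NormedSpace ℂ (NegSpace A) :=
  inferInstanceAs (NormedSpace ℂ (PosSpace A →L⋆[ℂ] ℂ))

instance : CompleteSpace (NegSpace A) :=
  inferInstanceAs (CompleteSpace (PosSpace A →L⋆[ℂ] ℂ))

/-- The value of a functional in `H₋` at a vector of `H₊`. -/
def eval {A : H →ₗ.[ℂ] H} (g : PosSpace A) : NegSpace A →L[ℂ] ℂ :=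
  (ContinuousLinearMap.apply' ℂ (starRingEnd ℂ) g : (PosSpace A →L⋆[ℂ] ℂ) →L[ℂ] ℂ)

lemma ext {A : H →ₗ.[ℂ] H} {F G : NegSpace A} (h : ∀ g, eval g F = eval g G) : F = G :=
  ContinuousLinearMap.ext (f := (F : PosSpace A →L⋆[ℂ] ℂ)) h

end NegSpace

/-- The antilinear functional `g ↦ (f, T g)` of `H₊`, for `f` in `H` and bounded `T : H₊ → H`
(the pairing being linear in `f`), as a bounded linear map of `f`: the adjoint of `T`. -/
def adjointToNeg (A : H →ₗ.[ℂ] H) (T : PosSpace A →L[ℂ] H) : H →L[ℂ] NegSpace A :=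
  show H →L[ℂ] PosSpace A →L⋆[ℂ] ℂ from LinearMap.mkContinuous₂
    (LinearMap.mk₂'ₛₗ (RingHom.id ℂ) (starRingEnd ℂ) (fun (f : H) (g : PosSpace A) =>
        inner ℂ (T g) f)
      (fun f f' g => inner_add_right _ _ _)
      (fun c f g => inner_smul_right _ _ _)
      (fun f g g' => by simp only [map_add, inner_add_left])
      (fun c f g => by simp only [map_smul, inner_smul_left, smul_eq_mul])) ‖T‖ fun f g => by
    calc ‖inner ℂ (T g) f‖ ≤ ‖T g‖ * ‖f‖ := norm_inner_le_norm _ _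
      _ ≤ ‖T‖ * ‖g‖ * ‖f‖ := by gcongr; exact T.le_opNorm g
      _ = ‖T‖ * ‖f‖ * ‖g‖ := by ring

/-- The embedding `H → H₋`, `f ↦ (f, ·)`. -/
def toNeg (A : H →ₗ.[ℂ] H) : H →L[ℂ] NegSpace A := adjointToNeg A (PosSpace.incl A)

/-- The operator `Ã : H → H₋`, the adjoint of `A : H₊ → H`. -/
def extOp (A : H →ₗ.[ℂ] H) : H →L[ℂ] NegSpace A := adjointToNeg A (PosSpace.op A)

lemma toNeg_apply (A : H →ₗ.[ℂ] H) (f : H) (g : PosSpace A) :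
    NegSpace.eval g (toNeg A f) = inner ℂ (PosSpace.incl A g) f := rfl

lemma extOp_apply (A : H →ₗ.[ℂ] H) (f : H) (g : PosSpace A) :
    NegSpace.eval g (extOp A f) = inner ℂ (PosSpace.op A g) f := rfl

/-- The operator `Ã` extends the symmetric operator `A`. -/
lemma extOp_eq_toNeg {A : H →ₗ.[ℂ] H} (hA : A.IsFormalAdjoint A) (f : PosSpace A) :
    extOp A (PosSpace.incl A f) = toNeg A (PosSpace.op A f) := by
  refine NegSpace.ext fun g => ?_
  obtain ⟨f, rfl⟩ := PosSpace.exists_ofDomain A f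
  obtain ⟨g, rfl⟩ := PosSpace.exists_ofDomain A g
  exact hA g f

lemma toNeg_injective {A : H →ₗ.[ℂ] H} (hA : Dense (A.domain : Set H)) :
    Function.Injective (toNeg A) := by
  rw [injective_iff_map_eq_zero]
  intro f hf
  refine hA.eq_zero_of_inner_right ℂ fun g hg => ?_
  exact (congrArg (NegSpace.eval (PosSpace.ofDomain A ⟨g, hg⟩)) hf).trans (map_zero _)

/-! ### The maximal and the minimal operator on an open set of the line -/

/-- The Hilbert space `L²(H, I)`. -/
abbrev L2 (H : Type*) [NormedAddCommGroup H] (I : Set ℝ) : Type _ :=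
  Lp H 2 (volume.restrict I)

/-- `v'` is the weak derivative of `v` on the open set `I`, both being locally integrable. -/
structure HasWeakDeriv {F : Type*} [NormedAddCommGroup F] [NormedSpace ℝ F]
    (I : Set ℝ) (v v' : ℝ → F) : Prop where
  locInt : LocallyIntegrableOn v I volume
  locInt_deriv : LocallyIntegrableOn v' I volume
  integral_eq : ∀ φ : ℝ → ℝ, ContDiff ℝ ∞ φ → HasCompactSupport φ → tsupport φ ⊆ I →
    ∫ t in I, deriv φ t • v t = -∫ t in I, φ t • v' t

/-- `u ∈ L²(H, I)` has a weak derivative `u'` with values in `H₋`, and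
`i u' + Ã u = w ∈ L²(H, I)`. -/
def SolvesExpr (A : H →ₗ.[ℂ] H) (I : Set ℝ) (u w : L2 H I) : Prop :=
  ∃ u' : ℝ → NegSpace A, HasWeakDeriv I (fun t => toNeg A (u t)) u' ∧
    ∀ᵐ t ∂(volume.restrict I), Complex.I • u' t + extOp A (u t) = toNeg A (w t)

section WeakDeriv

variable {F : Type*} [NormedAddCommGroup F] {I : Set ℝ}

lemma integrableOn_smul_of_tsupport [NormedSpace ℝ F] {v : ℝ → F}
    (hv : LocallyIntegrableOn v I volume) {φ : ℝ → ℝ} (hφ : Continuous φ)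
    (hc : HasCompactSupport φ) (hs : tsupport φ ⊆ I) :
    IntegrableOn (fun t => φ t • v t) I volume := by
  have h1 : IntegrableOn v (tsupport φ) volume :=
    hv.integrableOn_compact_subset hs hc
  have h2 : IntegrableOn (fun t => φ t • v t) (tsupport φ) volume :=
    h1.continuousOn_smul hφ.continuousOn hc
  refine IntegrableOn.integrable_of_forall_notMem_eq_zero h2 (fun t ht => ?_) |>.integrableOn
  rw [image_eq_zero_of_notMem_tsupport ht, zero_smul]

lemma HasWeakDeriv.add [NormedSpace ℝ F] {v v' w w' : ℝ → F} (hv : HasWeakDeriv I v v')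
    (hw : HasWeakDeriv I w w') :
    HasWeakDeriv I (fun t => v t + w t) (fun t => v' t + w' t) where
  locInt := hv.locInt.add hw.locInt
  locInt_deriv := hv.locInt_deriv.add hw.locInt_deriv
  integral_eq φ h1 h2 h3 := by
    have hd : Continuous (deriv φ) := h1.continuous_deriv (by simp)
    have hds : tsupport (deriv φ) ⊆ I := tsupport_deriv_subset.trans h3
    simp only [smul_add]
    rw [integral_add (integrableOn_smul_of_tsupport hv.locInt hd h2.deriv hds)
        (integrableOn_smul_of_tsupport hw.locInt hd h2.deriv hds),
      integral_add (integrableOn_smul_of_tsupport hv.locInt_deriv h1.continuous h2 h3)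
        (integrableOn_smul_of_tsupport hw.locInt_deriv h1.continuous h2 h3),
      hv.integral_eq φ h1 h2 h3, hw.integral_eq φ h1 h2 h3, neg_add]

lemma HasWeakDeriv.const_smul [NormedSpace ℝ F] [NormedSpace ℂ F] [SMulCommClass ℝ ℂ F]
    {v v' : ℝ → F} (hv : HasWeakDeriv I v v') (c : ℂ) :
    HasWeakDeriv I (fun t => c • v t) (fun t => c • v' t) where
  locInt := fun t ht => (hv.locInt t ht).smul c
  locInt_deriv := fun t ht => (hv.locInt_deriv t ht).smul c
  integral_eq φ h1 h2 h3 := by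
    simp only [smul_comm _ c]
    rw [integral_smul, integral_smul, hv.integral_eq φ h1 h2 h3, smul_neg]

lemma HasWeakDeriv.congr [NormedSpace ℝ F] {v v' w : ℝ → F} (hv : HasWeakDeriv I v v')
    (h : v =ᵐ[volume.restrict I] w) : HasWeakDeriv I w v' where
  locInt := hv.locInt.congr h
  locInt_deriv := hv.locInt_deriv
  integral_eq φ h1 h2 h3 := by
    rw [← hv.integral_eq φ h1 h2 h3]
    refine integral_congr_ae ?_
    filter_upwards [h] with t ht
    rw [ht]

lemma HasWeakDeriv.zero [NormedSpace ℝ F] : HasWeakDeriv I (fun _ => (0 : F)) (fun _ => 0) where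
  locInt := locallyIntegrableOn_zero
  locInt_deriv := locallyIntegrableOn_zero
  integral_eq φ h1 h2 h3 := by simp

/-- The weak derivative of zero is zero. -/
lemma HasWeakDeriv.ae_eq_zero [NormedSpace ℝ F] [CompleteSpace F] {v v' : ℝ → F}
    (hv : HasWeakDeriv I v v') (hI : IsOpen I) (h : v =ᵐ[volume.restrict I] fun _ => 0) :
    v' =ᵐ[volume.restrict I] fun _ => 0 := by
  have h0 := hv.congr h
  have := hI.ae_eq_zero_of_integral_contDiff_smul_eq_zero hv.locInt_deriv
    (fun φ h1 h2 h3 => by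
      have h4 := h0.integral_eq φ h1 h2 h3
      simp only [smul_zero, integral_zero] at h4
      rw [← setIntegral_eq_integral_of_forall_compl_eq_zero (s := I)]
      · exact (neg_eq_zero.1 h4.symm)
      · intro t ht
        rw [image_eq_zero_of_notMem_tsupport (fun h => ht (h3 h)), zero_smul])
  exact (ae_restrict_iff' hI.measurableSet).2 this

end WeakDeriv

lemma coeFn_zero_ae {K : Type*} [NormedAddCommGroup K] (I : Set ℝ) :
    ((0 : L2 K I) : ℝ → K) =ᵐ[volume.restrict I] fun _ => (0 : K) := by
  have h := Lp.coeFn_zero K 2 (volume.restrict I)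
  exact h

lemma SolvesExpr.zero (A : H →ₗ.[ℂ] H) (I : Set ℝ) : SolvesExpr A I 0 0 := by
  have h0 := coeFn_zero_ae (K := H) I
  refine ⟨fun _ => 0, HasWeakDeriv.zero.congr ?_, ?_⟩
  · filter_upwards [h0] with t ht
    rw [ht, map_zero]
  · filter_upwards [h0] with t ht
    rw [ht, map_zero, map_zero, smul_zero, add_zero]

lemma SolvesExpr.add {A : H →ₗ.[ℂ] H} {I : Set ℝ} {u w u₂ w₂ : L2 H I}
    (h : SolvesExpr A I u w) (h₂ : SolvesExpr A I u₂ w₂) :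
    SolvesExpr A I (u + u₂) (w + w₂) := by
  obtain ⟨u', h1, h2⟩ := h
  obtain ⟨u₂', h3, h4⟩ := h₂
  refine ⟨_, (h1.add h3).congr ?_, ?_⟩
  · filter_upwards [Lp.coeFn_add u u₂] with t ht
    rw [ht, Pi.add_apply, map_add]
  · filter_upwards [h2, h4, Lp.coeFn_add u u₂, Lp.coeFn_add w w₂] with t e1 e2 e3 e4
    rw [e3, e4, Pi.add_apply, Pi.add_apply, map_add, map_add, ← e1, ← e2, smul_add]
    abel

lemma SolvesExpr.smul {A : H →ₗ.[ℂ] H} {I : Set ℝ} {u w : L2 H I} (c : ℂ)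
    (h : SolvesExpr A I u w) : SolvesExpr A I (c • u) (c • w) := by
  obtain ⟨u', h1, h2⟩ := h
  refine ⟨_, (h1.const_smul c).congr ?_, ?_⟩
  · filter_upwards [Lp.coeFn_smul c u] with t ht
    rw [ht, Pi.smul_apply, map_smul]
  · filter_upwards [h2, Lp.coeFn_smul c u, Lp.coeFn_smul c w] with t e1 e3 e4
    rw [e3, e4, Pi.smul_apply, Pi.smul_apply, map_smul, map_smul, ← e1, smul_add, smul_comm]

/-- The graph of the maximal operator: the pairs `(u, w)` with `i u' + Ã u = w`. -/
def maxGraph (A : H →ₗ.[ℂ] H) (I : Set ℝ) : Submodule ℂ (L2 H I × L2 H I) where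
  carrier := {p | SolvesExpr A I p.1 p.2}
  zero_mem' := SolvesExpr.zero A I
  add_mem' h h₂ := SolvesExpr.add h h₂
  smul_mem' c _ h := SolvesExpr.smul c h

/-- The maximal operator `u ↦ i u' + Ã u` in `L²(H, I)`: its domain consists of all `u` in
`L²(H, I)` for which `i u' + Ã u` is in `L²(H, I)`. -/
def maximal (A : H →ₗ.[ℂ] H) (I : Set ℝ) : L2 H I →ₗ.[ℂ] L2 H I := (maxGraph A I).toLinearPMap

/-- For densely defined `A` and open `I` the set `maxGraph A I` is the graph of an operator. -/
lemma maxGraph_isGraph {A : H →ₗ.[ℂ] H} (hA : Dense (A.domain : Set H)) {I : Set ℝ}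
    (hI : IsOpen I) : ∀ p ∈ maxGraph A I, p.1 = 0 → p.2 = 0 := by
  rintro ⟨u, w⟩ ⟨u', h1, h2⟩ (rfl : u = 0)
  have h0 := coeFn_zero_ae (K := H) I
  have h3 := h1.ae_eq_zero hI (by filter_upwards [h0] with t ht; exact (congrArg _ ht).trans (map_zero _))
  refine (Lp.eq_zero_iff_ae_eq_zero).2 ?_
  filter_upwards [h0, h2, h3] with t e0 e2 e3
  refine toNeg_injective hA ?_
  rw [← e2, e3]
  change Complex.I • 0 + extOp A (((0 : L2 H I) : ℝ → H) t) = toNeg A 0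
  rw [e0, smul_zero, map_zero, map_zero, add_zero]

lemma maximal_graph {A : H →ₗ.[ℂ] H} (hA : Dense (A.domain : Set H)) {I : Set ℝ}
    (hI : IsOpen I) : (maximal A I).graph = maxGraph A I :=
  Submodule.toLinearPMap_graph_eq _ (maxGraph_isGraph hA hI)

/-- The elements of `L²(H, I)` given by smooth functions with values in `H₊` and with compact
support in `I`. -/
def testSpace (A : H →ₗ.[ℂ] H) (I : Set ℝ) : Submodule ℂ (L2 H I) where
  carrier := {u | ∃ φ : ℝ → PosSpace A, ContDiff ℝ ∞ φ ∧ HasCompactSupport φ ∧ tsupport φ ⊆ I ∧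
    u =ᵐ[volume.restrict I] fun t => PosSpace.incl A (φ t)}
  zero_mem' := by
    refine ⟨fun _ => 0, contDiff_const, HasCompactSupport.zero, ?_, ?_⟩
    · simp [tsupport, Function.support]
    · filter_upwards [coeFn_zero_ae (K := H) I] with t ht
      rw [ht, map_zero]
  add_mem' := by
    rintro u v ⟨φ, h1, h2, h3, h4⟩ ⟨ψ, k1, k2, k3, k4⟩
    refine ⟨fun t => φ t + ψ t, h1.add k1, h2.add k2,
      (tsupport_add φ ψ).trans (union_subset h3 k3), ?_⟩
    filter_upwards [Lp.coeFn_add u v, h4, k4] with t e1 e2 e3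
    rw [e1, Pi.add_apply, e2, e3, map_add]
  smul_mem' := by
    rintro c u ⟨φ, h1, h2, h3, h4⟩
    refine ⟨fun t => c • φ t, h1.const_smul c, h2.smul_left (f := fun _ => c),
      (closure_mono (Function.support_const_smul_subset c φ)).trans h3, ?_⟩
    filter_upwards [Lp.coeFn_smul c u, h4] with t e1 e2
    rw [e1, Pi.smul_apply, e2, map_smul]

/-- Every test function is in the domain of the maximal operator, which acts on it as
`φ ↦ i φ' + A φ`. -/
lemma exists_maximal_of_test {A : H →ₗ.[ℂ] H} (hA : A.IsFormalAdjoint A) {I : Set ℝ}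
    {φ : ℝ → PosSpace A} (h1 : ContDiff ℝ ∞ φ)
    (h2 : HasCompactSupport φ) {u : L2 H I}
    (h4 : u =ᵐ[volume.restrict I] fun t => PosSpace.incl A (φ t)) :
    ∃ w : L2 H I, (u, w) ∈ maxGraph A I ∧ w =ᵐ[volume.restrict I] fun t =>
      Complex.I • PosSpace.incl A (deriv φ t) + PosSpace.op A (φ t) := by
  have hd : Continuous (deriv φ) := h1.continuous_deriv (by simp)
  have hwc : Continuous fun t => Complex.I • PosSpace.incl A (deriv φ t) + PosSpace.op A (φ t) := by
    have := h1.continuous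
    fun_prop
  have hws : HasCompactSupport fun t =>
      Complex.I • PosSpace.incl A (deriv φ t) + PosSpace.op A (φ t) := by
    refine HasCompactSupport.add ?_ ?_
    · exact (h2.deriv.comp_left (g := fun x => Complex.I • PosSpace.incl A x) (by simp))
    · exact (h2.comp_left (g := fun x => PosSpace.op A x) (by simp))
  have hm : MemLp (fun t => Complex.I • PosSpace.incl A (deriv φ t) + PosSpace.op A (φ t)) 2
      (volume.restrict I) := (hwc.memLp_of_hasCompactSupport hws).restrict I
  refine ⟨hm.toLp _, ?_, hm.coeFn_toLp⟩
  let J : PosSpace A →L[ℝ] NegSpace A :=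
    ((toNeg A).comp (PosSpace.incl A)).restrictScalars ℝ
  refine ⟨fun t => J (deriv φ t), ⟨?_, ?_, ?_⟩, ?_⟩
  · have : LocallyIntegrableOn (fun t => J (φ t)) I volume :=
      ((J.continuous.comp h1.continuous).locallyIntegrable).locallyIntegrableOn I
    refine this.congr ?_
    filter_upwards [h4] with t e1
    rw [e1]
    rfl
  · exact ((J.continuous.comp hd).locallyIntegrable).locallyIntegrableOn I
  · intro χ k1 k2 k3
    have kd : Continuous (deriv χ) := k1.continuous_deriv (by simp)
    have e1 : ∫ t in I, deriv χ t • toNeg A (u t) = ∫ t in I, deriv χ t • J (φ t) := by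
      refine integral_congr_ae ?_
      filter_upwards [h4] with t e1
      rw [e1]
      rfl
    rw [e1, setIntegral_eq_integral_of_forall_compl_eq_zero,
      setIntegral_eq_integral_of_forall_compl_eq_zero]
    · rw [eq_neg_iff_add_eq_zero, add_comm, ← eq_neg_iff_add_eq_zero]
      have hJc : Continuous fun t => J (φ t) := J.continuous.comp h1.continuous
      have hJd : Continuous fun t => J (deriv φ t) := J.continuous.comp hd
      refine integral_bilinear_hasDerivAt_right_eq_neg_left_of_integrable
        (L := ContinuousLinearMap.lsmul ℝ ℝ) (u := χ) (v := fun t => J (φ t)) ?_ ?_ ?_ ?_ ?_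
      · intro t _
        exact (k1.differentiable (by simp) t).hasDerivAt
      · intro t _
        exact J.hasFDerivAt.comp_hasDerivAt t (h1.differentiable (by simp) t).hasDerivAt
      · exact (k1.continuous.smul hJd).integrable_of_hasCompactSupport k2.smul_right
      · exact (kd.smul hJc).integrable_of_hasCompactSupport k2.deriv.smul_right
      · exact (k1.continuous.smul hJc).integrable_of_hasCompactSupport k2.smul_right
    · intro t ht
      rw [image_eq_zero_of_notMem_tsupport (fun h => ht (k3 h)), zero_smul]
    · intro t ht
      rw [image_eq_zero_of_notMem_tsupport (fun h => ht (k3 (tsupport_deriv_subset h))),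
        zero_smul]
  · filter_upwards [h4, hm.coeFn_toLp] with t e1 e2
    rw [e1, e2, map_add, map_smul, extOp_eq_toNeg hA]
    rfl

lemma testSpace_le_domain {A : H →ₗ.[ℂ] H} (hA : A.IsFormalAdjoint A) (I : Set ℝ) :
    testSpace A I ≤ (maximal A I).domain := by
  rintro u ⟨φ, h1, h2, -, h4⟩
  obtain ⟨w, hw, -⟩ := exists_maximal_of_test hA h1 h2 h4
  exact ⟨(u, w), hw, rfl⟩

/-- The minimal operator in `L²(H, I)`: the closure of `u ↦ i u' + A u` on the smooth functions
with values in `H₊` and with compact support in `I`. -/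
def minimal (A : H →ₗ.[ℂ] H) (I : Set ℝ) : L2 H I →ₗ.[ℂ] L2 H I :=
  ((maximal A I).domRestrict (testSpace A I)).closure

/-! ### Direct sums, boundary conditions, point spectrum -/

/-- The orthogonal direct sum `S ⊕ T` of operators in `E` and `F`. -/
def directSum {E F : Type*} [NormedAddCommGroup E] [InnerProductSpace ℂ E]
    [NormedAddCommGroup F] [InnerProductSpace ℂ F] (S : E →ₗ.[ℂ] E) (T : F →ₗ.[ℂ] F) :
    WithLp 2 (E × F) →ₗ.[ℂ] WithLp 2 (E × F) where
  domain :=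
    { carrier := {x | x.fst ∈ S.domain ∧ x.snd ∈ T.domain}
      zero_mem' := ⟨S.domain.zero_mem, T.domain.zero_mem⟩
      add_mem' := fun h k => ⟨S.domain.add_mem h.1 k.1, T.domain.add_mem h.2 k.2⟩
      smul_mem' := fun c _ h => ⟨S.domain.smul_mem c h.1, T.domain.smul_mem c h.2⟩ }
  toFun :=
    { toFun := fun x => WithLp.toLp 2 (S ⟨x.1.fst, x.2.1⟩, T ⟨x.1.snd, x.2.2⟩)
      map_add' := fun x y => by
        rw [← WithLp.toLp_add, Prod.mk_add_mk, ← S.map_add, ← T.map_add]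
        rfl
      map_smul' := fun c x => by
        rw [RingHom.id_apply, ← WithLp.toLp_smul, Prod.smul_mk, ← S.map_smul, ← T.map_smul]
        rfl }

/-- `u` has the boundary value `u(a) = x`: it has a representative `I → H` that extends
continuously to the closure of `I`, with the value `x` at the boundary point `a`. -/
def HasBoundaryValue {I : Set ℝ} (u : L2 H I) (a : ℝ) (x : H) : Prop :=
  ∃ v : ℝ → H, ContinuousOn v (closure I) ∧ u =ᵐ[volume.restrict I] v ∧ v a = x

/-- The Hilbert space `L²(H, (-∞, a₁)) ⊕ L²(H, (a₃, ∞))`. -/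
abbrev L2Sum (H : Type*) [NormedAddCommGroup H] (a₁ a₃ : ℝ) : Type _ :=
  WithLp 2 (L2 H (Iio a₁) × L2 H (Ioi a₃))

/-- The minimal operator `L₁₀ ⊕ L₃₀`. -/
def minimalSum (A₁ A₃ : H →ₗ.[ℂ] H) (a₁ a₃ : ℝ) : L2Sum H a₁ a₃ →ₗ.[ℂ] L2Sum H a₁ a₃ :=
  directSum (minimal A₁ (Iio a₁)) (minimal A₃ (Ioi a₃))

/-- The pairs `(u₁, u₃)` with `u₃(a₃) = W u₁(a₁)`. -/
def boundaryCondition (a₁ a₃ : ℝ) (W : H ≃ₗᵢ[ℂ] H) : Submodule ℂ (L2Sum H a₁ a₃) where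
  carrier := {u | ∃ x : H, HasBoundaryValue u.fst a₁ x ∧ HasBoundaryValue u.snd a₃ (W x)}
  zero_mem' := by
    refine ⟨0, ⟨fun _ => 0, continuousOn_const, Lp.coeFn_zero _ _ _, rfl⟩,
      ⟨fun _ => 0, continuousOn_const, Lp.coeFn_zero _ _ _, (map_zero W).symm⟩⟩
  add_mem' := by
    rintro u v ⟨x, ⟨f, h1, h2, h3⟩, ⟨g, k1, k2, k3⟩⟩ ⟨x', ⟨f', h1', h2', h3'⟩, ⟨g', k1', k2', k3'⟩⟩
    refine ⟨x + x', ⟨fun t => f t + f' t, h1.add h1', ?_, by simp only [h3, h3']⟩,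
      ⟨fun t => g t + g' t, k1.add k1', ?_, by simp only [k3, k3', map_add]⟩⟩
    · exact (Lp.coeFn_add _ _).trans (h2.add h2')
    · exact (Lp.coeFn_add _ _).trans (k2.add k2')
  smul_mem' := by
    rintro c u ⟨x, ⟨f, h1, h2, h3⟩, ⟨g, k1, k2, k3⟩⟩
    refine ⟨c • x, ⟨fun t => c • f t, h1.const_smul c, ?_, by simp only [h3]⟩,
      ⟨fun t => c • g t, k1.const_smul c, ?_, by simp only [k3, map_smul]⟩⟩
    · exact (Lp.coeFn_smul _ _).trans (h2.const_smul c)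
    · exact (Lp.coeFn_smul _ _).trans (k2.const_smul c)

/-- The operator `L_W`, generated by the expression `(i u₁' + Ã₁ u₁, i u₃' + Ã₃ u₃)` and the
boundary condition `u₃(a₃) = W u₁(a₁)`. -/
def extension (A₁ A₃ : H →ₗ.[ℂ] H) (a₁ a₃ : ℝ) (W : H ≃ₗᵢ[ℂ] H) :
    L2Sum H a₁ a₃ →ₗ.[ℂ] L2Sum H a₁ a₃ :=
  (directSum (maximal A₁ (Iio a₁)) (maximal A₃ (Ioi a₃))).domRestrict (boundaryCondition a₁ a₃ W)

/-- The point spectrum: the set of all eigenvalues of `S`. -/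
def pointSpectrum {E : Type*} [AddCommGroup E] [Module ℂ E] (S : E →ₗ.[ℂ] E) : Set ℂ :=
  {z | ∃ u : S.domain, (u : E) ≠ 0 ∧ S u = z • (u : E)}

end MultipointOperator

end

/-!
An eigenfunction solves `i u' + Ã u = z u` on each half-line. For bounded `A` the solution would be
`u(t) = exp(i (A - z) t) c`, so that `‖u(t)‖² = ‖c‖² exp(2 Im z · t)`. Hence `u` cannot be square
integrable on a half-line along which `exp(Im z · t)` does not decay, unless it vanishes; and it
also vanishes if its boundary value does.

For unbounded `A` no unitary group is used. Instead, `u` is regularized by the bounded operator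
`R = (1 + A²)⁻¹`, which is `J J†` for the inclusion `J : H₊ → H` and commutes with the bounded
selfadjoint operator `B = A R`. Testing the equation with `χ(t) J† h`, where `χ` is a scalar
function, shows that `R u` has the weak derivative `-i (z R u - B u)` in `H`
(`IsWeakEigenfunction.hasWeakDeriv`). By the du Bois-Reymond lemma (`HasWeakDeriv.exists_primitive`)
it has a continuous representative `V`, the primitive of its weak derivative. A second
regularization makes the integrand continuous: `y = R V` is continuously differentiable with
`y' = -i (z R V - B V)`, and since `(R V, B V)` is real, the derivative of `‖y‖²` is
`2 Im z · ‖y‖²` (`IsWeakEigenfunction.exists_norm_sq_eq`). As `R` is injective, what is known about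
`y = R² u` carries over to `u`.

For a selfadjoint extension `z` is real, and both components vanish. For the operator given by the
boundary condition `u₃(a₃) = W u₁(a₁)`, one of the two components vanishes by the sign of `Im z`;
then so do both boundary values, and with them the other component.
-/

open MeasureTheory Set
open scoped ContDiff ComplexConjugate

noncomputable section

namespace MultipointOperator

open ContinuousLinearMap

/-! ### Weak derivatives and primitives on an interval -/

section WeakDeriv

variable {F : Type*} [NormedAddCommGroup F] {I : Set ℝ}

lemma intervalIntegrable_of_locallyIntegrableOn [I.OrdConnected] {w : ℝ → F}
    (hw : LocallyIntegrableOn w I volume) {s t : ℝ} (hs : s ∈ I) (ht : t ∈ I) :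
    IntervalIntegrable w volume s t :=
  (intervalIntegrable_iff' (by simp)).2
    (hw.integrableOn_compact_subset (Set.OrdConnected.uIcc_subset ‹_› hs ht) isCompact_uIcc)

variable [NormedSpace ℝ F]

/-- Integration by parts against the primitive of a merely integrable function, by Fubini. -/
lemma integral_deriv_smul_integral_Iic [CompleteSpace F] {w : ℝ → F} (hw : Integrable w)
    {χ : ℝ → ℝ} (hχ : ContDiff ℝ 1 χ) (hc : HasCompactSupport χ) :
    ∫ t, deriv χ t • ∫ s in Iic t, w s = -∫ t, χ t • w t := by
  have hd : Integrable (deriv χ) :=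
    (hχ.continuous_deriv le_rfl).integrable_of_hasCompactSupport hc.deriv
  have hS : MeasurableSet {p : ℝ × ℝ | p.2 ≤ p.1} := measurableSet_le measurable_snd measurable_fst
  have hint : Integrable (fun p : ℝ × ℝ =>
      {p : ℝ × ℝ | p.2 ≤ p.1}.indicator (fun p => deriv χ p.1 • w p.2) p)
      (volume.prod volume) := (hd.smul_prod hw).indicator hS
  have e1 : ∀ t, deriv χ t • ∫ s in Iic t, w s =
      ∫ s, {p : ℝ × ℝ | p.2 ≤ p.1}.indicator (fun p => deriv χ p.1 • w p.2) (t, s) := by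
    intro t
    rw [← integral_smul, ← integral_indicator measurableSet_Iic]
    rfl
  have e2 : ∀ s, ∫ t, {p : ℝ × ℝ | p.2 ≤ p.1}.indicator (fun p => deriv χ p.1 • w p.2) (t, s) =
      -(χ s • w s) := by
    intro s
    rw [← neg_smul, ← hc.integral_Ioi_deriv_eq hχ s, ← integral_Ici_eq_integral_Ioi,
      ← integral_smul_const, ← integral_indicator measurableSet_Ici]
    rfl
  simp only [e1]
  rw [integral_integral_swap hint]
  simp only [e2]
  exact integral_neg _

lemma exists_Icc_of_isCompact [I.OrdConnected] (hne : I.Nonempty) {K : Set ℝ} (hK : IsCompact K)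
    (hKI : K ⊆ I) : ∃ α β, α ≤ β ∧ K ⊆ Icc α β ∧ Icc α β ⊆ I := by
  obtain ⟨c, hc⟩ := hne
  have h1 : IsCompact (insert c K) := hK.insert c
  have h2 : insert c K ⊆ I := insert_subset hc hKI
  obtain ⟨α, hα, hα'⟩ := h1.exists_isLeast (insert_nonempty c K)
  obtain ⟨β, hβ, hβ'⟩ := h1.exists_isGreatest (insert_nonempty c K)
  exact ⟨α, β, hα' hβ, fun x hx => ⟨hα' (mem_insert_of_mem _ hx), hβ' (mem_insert_of_mem _ hx)⟩,
    Set.OrdConnected.out ‹_› (h2 hα) (h2 hβ)⟩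

lemma continuousOn_integral_of_locallyIntegrableOn [I.OrdConnected] (hI : IsOpen I) {w : ℝ → F}
    (hw : LocallyIntegrableOn w I volume) {c : ℝ} (hc : c ∈ I) :
    ContinuousOn (fun t => ∫ s in c..t, w s) I := by
  intro t ht
  obtain ⟨ε, hε, hball⟩ := Metric.isOpen_iff.1 hI t ht
  have h1 : t - ε / 2 ∈ I := hball (by simp [abs_of_pos hε]; linarith)
  have h2 : t + ε / 2 ∈ I := hball (by simp [abs_of_pos hε]; linarith)
  have h3 : ContinuousWithinAt (fun t => ∫ s in c..t, w s) (Icc (t - ε / 2) (t + ε / 2)) t := by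
    refine intervalIntegral.continuousWithinAt_primitive (by simp) ?_
    refine intervalIntegrable_of_locallyIntegrableOn hw ?_ ?_
    · rcases min_choice c (t - ε / 2) with h | h <;> rw [h] <;> assumption
    · rcases max_choice c (t + ε / 2) with h | h <;> rw [h] <;> assumption
  exact (h3.continuousAt (Icc_mem_nhds (by linarith) (by linarith))).continuousWithinAt

lemma hasWeakDeriv_integral [CompleteSpace F] [I.OrdConnected] (hI : IsOpen I) {w : ℝ → F}
    (hw : LocallyIntegrableOn w I volume) {c : ℝ} (hc : c ∈ I) :
    HasWeakDeriv I (fun t => ∫ s in c..t, w s) w where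
  locInt := (continuousOn_integral_of_locallyIntegrableOn hI hw hc).locallyIntegrableOn
    hI.measurableSet
  locInt_deriv := hw
  integral_eq χ h1 h2 h3 := by
    obtain ⟨α, β, hαβ, hχ, hsub⟩ := exists_Icc_of_isCompact ⟨c, hc⟩ h2 h3
    have hα : α ∈ I := hsub ⟨le_rfl, hαβ⟩
    have hχ1 : ContDiff ℝ 1 χ := h1.of_le (by simp)
    have hwi : Integrable ((Ioc α β).indicator w) := by
      rw [integrable_indicator_iff measurableSet_Ioc]
      exact (hw.integrableOn_compact_subset hsub isCompact_Icc).mono_set Ioc_subset_Icc_self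
    have h0 : ∀ t ∉ Icc α β, χ t = 0 := fun t ht =>
      image_eq_zero_of_notMem_tsupport fun h => ht (hχ h)
    have h0' : ∀ t ∉ Icc α β, deriv χ t = 0 := fun t ht =>
      image_eq_zero_of_notMem_tsupport fun h => ht (hχ (tsupport_deriv_subset h))
    -- The primitive of the truncated function differs from the given one by a constant on the
    -- support of `χ`, and the integral of `deriv χ` vanishes.
    have key := integral_deriv_smul_integral_Iic hwi hχ1 h2
    have e1 : ∀ t, deriv χ t • ∫ s in Iic t, (Ioc α β).indicator w s =
        deriv χ t • (∫ s in c..t, w s) - deriv χ t • (∫ s in c..α, w s) := by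
      intro t
      by_cases ht : t ∈ Icc α β
      · have hc1 := intervalIntegrable_of_locallyIntegrableOn hw hc (hsub ht)
        have hc2 := intervalIntegrable_of_locallyIntegrableOn hw hc hα
        have hset : Iic t ∩ Ioc α β = Ioc α t := by
          ext s
          exact ⟨fun h => ⟨h.2.1, h.1⟩, fun h => ⟨h.2, h.1, h.2.trans ht.2⟩⟩
        rw [← smul_sub, setIntegral_indicator measurableSet_Ioc, hset,
          intervalIntegral.integral_interval_sub_left hc1 hc2,
          intervalIntegral.integral_of_le ht.1]
      · simp [h0' t ht]
    have hV := continuousOn_integral_of_locallyIntegrableOn hI hw hc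
    have hd : Continuous (deriv χ) := hχ1.continuous_deriv le_rfl
    have hds : tsupport (deriv χ) ⊆ I := tsupport_deriv_subset.trans h3
    have i1 := integrableOn_smul_of_tsupport (hV.locallyIntegrableOn hI.measurableSet) hd
      h2.deriv hds
    have hout : ∀ (f : ℝ → F), ∫ t in I, deriv χ t • f t = ∫ t, deriv χ t • f t := fun f =>
      setIntegral_eq_integral_of_forall_compl_eq_zero fun t ht => by
        rw [h0' t fun h => ht (hsub h), zero_smul]
    have hout' : ∀ (f : ℝ → F), ∫ t in I, χ t • f t = ∫ t, χ t • f t := fun f =>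
      setIntegral_eq_integral_of_forall_compl_eq_zero fun t ht => by
        rw [h0 t fun h => ht (hsub h), zero_smul]
    have i2 : IntegrableOn (fun t => deriv χ t • (∫ s in c..α, w s)) I :=
      ((hd.integrable_of_hasCompactSupport h2.deriv).smul_const _).integrableOn
    have e2 : ∫ t, deriv χ t • (∫ s in c..α, w s) = 0 := by
      rw [integral_smul_const, integral_eq_zero_of_hasDerivAt_of_integrable
        (fun t => (hχ1.differentiable one_ne_zero t).hasDerivAt)
        (hd.integrable_of_hasCompactSupport h2.deriv)
        (hχ1.continuous.integrable_of_hasCompactSupport h2), zero_smul]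
    have e3 : ∫ t, χ t • (Ioc α β).indicator w t = ∫ t in I, χ t • w t := by
      rw [hout', integral_congr_ae]
      have : ∀ᵐ t ∂(volume : Measure ℝ), t ≠ α := by simp [ae_iff]
      filter_upwards [this] with t ht
      by_cases h : t ∈ Ioc α β
      · rw [indicator_of_mem h]
      · rw [h0 t fun h' => h ⟨lt_of_le_of_ne h'.1 ht.symm, h'.2⟩, zero_smul, zero_smul]
    rw [← e3, ← key, ← sub_zero (∫ t in I, _), ← e2, ← hout, ← integral_sub i1 i2, ← hout]
    simp only [e1]

/-- The du Bois-Reymond lemma: on an interval, a function with weak derivative zero is almost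
everywhere constant. -/
lemma HasWeakDeriv.exists_ae_eq_const [CompleteSpace F] [I.OrdConnected] (hI : IsOpen I)
    (hne : I.Nonempty) {v : ℝ → F} (hv : HasWeakDeriv I v fun _ => 0) :
    ∃ k : F, v =ᵐ[volume.restrict I] fun _ => k := by
  obtain ⟨c, hc⟩ := hne
  obtain ⟨ε, hε, hball⟩ := Metric.isOpen_iff.1 hI c hc
  let b : ContDiffBump c := ⟨ε / 4, ε / 2, by positivity, by linarith⟩
  let ψ : ℝ → ℝ := b.normed volume
  have hψ1 : ContDiff ℝ ∞ ψ := b.contDiff_normed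
  have hψc : HasCompactSupport ψ := b.hasCompactSupport_normed
  have hψI : tsupport ψ ⊆ I := by
    rw [b.tsupport_normed_eq]
    exact (Metric.closedBall_subset_ball (by simp only [b]; linarith)).trans hball
  have hψi : ∫ t, ψ t = 1 := b.integral_normed
  have out : ∀ (φ : ℝ → ℝ), tsupport φ ⊆ I → ∀ f : ℝ → F,
      ∫ t in I, φ t • f t = ∫ t, φ t • f t := fun φ hφ f =>
    setIntegral_eq_integral_of_forall_compl_eq_zero fun t ht => by
      rw [image_eq_zero_of_notMem_tsupport fun h => ht (hφ h), zero_smul]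
  refine ⟨∫ t, ψ t • v t, ?_⟩
  set k := ∫ t, ψ t • v t with hk
  have hkl : LocallyIntegrableOn (fun _ : ℝ => k) I volume :=
    continuousOn_const.locallyIntegrableOn hI.measurableSet
  have h0 : ∀ᵐ t ∂volume, t ∈ I → v t - k = 0 := by
    refine hI.ae_eq_zero_of_integral_contDiff_smul_eq_zero (hv.locInt.sub hkl) ?_
    intro φ h1 h2 h3
    -- A test function with integral zero is the derivative of a test function.
    set m := ∫ t, φ t with hm
    let θ : ℝ → ℝ := fun t => φ t - m * ψ t
    have hθ1 : ContDiff ℝ ∞ θ := h1.sub (contDiff_const.mul hψ1)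
    obtain ⟨α, β, hαβ, hK, hsub⟩ := exists_Icc_of_isCompact ⟨c, hc⟩ (h2.isCompact.union hψc)
      (union_subset h3 hψI)
    have hθ0 : ∀ t ∉ Icc α β, θ t = 0 := by
      intro t ht
      have e1 : φ t = 0 := image_eq_zero_of_notMem_tsupport fun h => ht (hK (Or.inl h))
      have e2 : ψ t = 0 := image_eq_zero_of_notMem_tsupport fun h => ht (hK (Or.inr h))
      simp [θ, e1, e2]
    have hφi : Integrable φ := h1.continuous.integrable_of_hasCompactSupport h2
    have hψi' : Integrable ψ := hψ1.continuous.integrable_of_hasCompactSupport hψc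
    have hθi : ∫ t, θ t = 0 := by
      simp only [θ]
      rw [integral_sub hφi (hψi'.const_mul m), integral_const_mul, hψi]
      simp [hm]
    let χ : ℝ → ℝ := fun t => ∫ s in α..t, θ s
    have hχd : ∀ t, HasDerivAt χ (θ t) t := fun t =>
      intervalIntegral.integral_hasDerivAt_right (hθ1.continuous.intervalIntegrable _ _)
        (hθ1.continuous.stronglyMeasurableAtFilter _ _) hθ1.continuous.continuousAt
    have hχ' : deriv χ = θ := funext fun t => (hχd t).deriv
    have hχ1 : ContDiff ℝ ∞ χ := by
      rw [contDiff_infty_iff_deriv]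
      exact ⟨fun t => (hχd t).differentiableAt, hχ' ▸ hθ1⟩
    have hχ0 : ∀ t ∉ Icc α β, χ t = 0 := by
      intro t ht
      by_cases h : t < α
      · refine intervalIntegral.integral_zero_ae ?_
        have : ∀ᵐ s ∂(volume : Measure ℝ), s ≠ α := by simp [ae_iff]
        filter_upwards [this] with s hs hs'
        rw [uIoc_of_ge h.le] at hs'
        exact hθ0 s fun h' => hs (le_antisymm hs'.2 h'.1)
      · have hβ : β < t := lt_of_not_ge fun h' => ht ⟨not_lt.1 h, h'⟩
        change ∫ s in α..t, θ s = 0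
        rw [intervalIntegral.integral_of_le (not_lt.1 h),
          ← integral_Icc_eq_integral_Ioc,
          setIntegral_eq_integral_of_forall_compl_eq_zero, hθi]
        intro s hs
        exact hθ0 s fun h' => hs ⟨h'.1, h'.2.trans hβ.le⟩
    have hχs : tsupport χ ⊆ Icc α β :=
      closure_minimal (fun t ht => by_contra fun h => ht (hχ0 t h)) isClosed_Icc
    have hχc : HasCompactSupport χ := HasCompactSupport.of_support_subset_isCompact isCompact_Icc
      (subset_closure.trans hχs)
    have key := hv.integral_eq χ hχ1 hχc (hχs.trans hsub)
    simp only [smul_zero, integral_zero, neg_zero, hχ'] at key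
    have iφ := integrableOn_smul_of_tsupport hv.locInt h1.continuous h2 h3
    have iψ := integrableOn_smul_of_tsupport hv.locInt hψ1.continuous hψc hψI
    have ik := integrableOn_smul_of_tsupport hkl h1.continuous h2 h3
    have e1 : ∫ t in I, φ t • v t = m • k := by
      have : ∫ t in I, θ t • v t = (∫ t in I, φ t • v t) - m • ∫ t in I, ψ t • v t := by
        simp only [θ, sub_smul, mul_smul]
        rw [← integral_smul]
        exact integral_sub iφ (iψ.smul m)
      rw [this, sub_eq_zero] at key
      rw [key, out ψ hψI, ← hk]
    rw [← out φ h3]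
    simp only [smul_sub]
    rw [integral_sub iφ ik, e1, out φ h3, integral_smul_const, ← hm, sub_self]
  refine (ae_restrict_iff' hI.measurableSet).2 ?_
  filter_upwards [h0] with t ht h
  exact sub_eq_zero.1 (ht h)

/-- On an interval, a function with a locally integrable weak derivative agrees almost everywhere
with a continuous function whose increments are the integrals of the weak derivative. -/
lemma HasWeakDeriv.exists_primitive [CompleteSpace F] [I.OrdConnected] (hI : IsOpen I)
    (hne : I.Nonempty) {v v' : ℝ → F} (hv : HasWeakDeriv I v v') :
    ∃ V : ℝ → F, v =ᵐ[volume.restrict I] V ∧ ContinuousOn V I ∧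
      ∀ s ∈ I, ∀ t ∈ I, V t - V s = ∫ r in s..t, v' r := by
  obtain ⟨c, hc⟩ := hne
  have hw := hasWeakDeriv_integral hI hv.locInt_deriv hc
  have hd : HasWeakDeriv I (fun t => v t - ∫ s in c..t, v' s) fun _ => 0 := by
    refine ⟨hv.locInt.sub hw.locInt, locallyIntegrableOn_zero, fun φ h1 h2 h3 => ?_⟩
    have hφ : Continuous (deriv φ) := h1.continuous_deriv (by simp)
    have hs : tsupport (deriv φ) ⊆ I := tsupport_deriv_subset.trans h3
    simp only [smul_sub]
    rw [integral_sub (integrableOn_smul_of_tsupport hv.locInt hφ h2.deriv hs)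
      (integrableOn_smul_of_tsupport hw.locInt hφ h2.deriv hs), hv.integral_eq φ h1 h2 h3,
      hw.integral_eq φ h1 h2 h3]
    simp
  obtain ⟨k, hk⟩ := hd.exists_ae_eq_const hI ⟨c, hc⟩
  refine ⟨fun t => k + ∫ s in c..t, v' s, ?_,
    continuousOn_const.add (continuousOn_integral_of_locallyIntegrableOn hI hv.locInt_deriv hc),
    fun s hs t ht => ?_⟩
  · filter_upwards [hk] with t ht
    rw [← ht, sub_add_cancel]
  · rw [add_sub_add_left_eq_sub, intervalIntegral.integral_interval_sub_left]
    · exact intervalIntegrable_of_locallyIntegrableOn hv.locInt_deriv hc ht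
    · exact intervalIntegrable_of_locallyIntegrableOn hv.locInt_deriv hc hs

end WeakDeriv

/-! ### Bounded functions of a selfadjoint operator -/

lemma isFormalAdjoint_self {E : Type*} [NormedAddCommGroup E] [InnerProductSpace ℂ E]
    [CompleteSpace E] {T : E →ₗ.[ℂ] E} (hT : IsSelfAdjoint T) : T.IsFormalAdjoint T := by
  have := LinearPMap.adjoint_isFormalAdjoint (T := T) hT.dense_domain
  rwa [LinearPMap.isSelfAdjoint_def.1 hT] at this

section Regularization

variable {H : Type*} [NormedAddCommGroup H] [InnerProductSpace ℂ H] {A : H →ₗ.[ℂ] H}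

lemma completeSpace_posSpace [CompleteSpace H] (hA : A.IsClosed) : CompleteSpace (PosSpace A) := by
  have h : IsClosed ((PosSpace A : Submodule ℂ (WithLp 2 (H × H))) : Set (WithLp 2 (H × H))) :=
    IsClosed.preimage (WithLp.prod_continuous_ofLp 2 H H) hA
  exact h.completeSpace_coe

lemma inner_posSpace (p q : PosSpace A) : inner ℂ p q =
    inner ℂ (PosSpace.incl A p) (PosSpace.incl A q) +
      inner ℂ (PosSpace.op A p) (PosSpace.op A q) := rfl

variable [CompleteSpace H]

lemma inner_op_left (hA : IsSelfAdjoint A) (p q : PosSpace A) :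
    inner ℂ (PosSpace.op A p) (PosSpace.incl A q) =
      inner ℂ (PosSpace.incl A p) (PosSpace.op A q) := by
  obtain ⟨f, rfl⟩ := PosSpace.exists_ofDomain A p
  obtain ⟨g, rfl⟩ := PosSpace.exists_ofDomain A q
  exact isFormalAdjoint_self hA f g

/-- The domain of `A† = A` consists of all `x` with `(x, A q) = (y, q)` for some `y` and all `q`. -/
lemma exists_posSpace_of_inner (hA : IsSelfAdjoint A) {x y : H}
    (h : ∀ q : PosSpace A, inner ℂ x (PosSpace.op A q) = inner ℂ y (PosSpace.incl A q)) :
    ∃ p : PosSpace A, PosSpace.incl A p = x ∧ PosSpace.op A p = y := by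
  have h' : ∀ q : A.domain, inner ℂ y (q : H) = inner ℂ x (A q) := fun q =>
    (h (PosSpace.ofDomain A q)).symm
  have hx : x ∈ A.adjoint.domain := LinearPMap.mem_adjoint_domain_of_exists x ⟨y, h'⟩
  have hy : A.adjoint ⟨x, hx⟩ = y := LinearPMap.adjoint_apply_eq hA.dense_domain ⟨x, hx⟩ h'
  have hg : (x, y) ∈ A.graph := by
    rw [← LinearPMap.isSelfAdjoint_def.1 hA, ← hy]
    exact A.adjoint.mem_graph ⟨x, hx⟩
  exact ⟨⟨WithLp.toLp 2 (x, y), hg⟩, rfl, rfl⟩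

variable [CompleteSpace (PosSpace A)]

variable (A) in
/-- The bounded operator `(1 + A²)⁻¹` of a selfadjoint operator `A`, obtained as `J J†` for the
inclusion `J : H₊ → H`. -/
def resolv : H →L[ℂ] H := PosSpace.incl A ∘L adjoint (PosSpace.incl A)

variable (A) in
/-- The bounded operator `A (1 + A²)⁻¹` of a selfadjoint operator `A`. -/
def opResolv : H →L[ℂ] H := PosSpace.op A ∘L adjoint (PosSpace.incl A)

/-- The identity `A J† = J A†` of bounded operators in `H`, where `A` and the inclusion `J` are
regarded as bounded maps `H₊ → H`; it makes `A (1 + A²)⁻¹` selfadjoint. -/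
lemma op_adjoint_incl_eq (hA : IsSelfAdjoint A) (h : H) :
    PosSpace.op A (adjoint (PosSpace.incl A) h) = PosSpace.incl A (adjoint (PosSpace.op A) h) := by
  set p := adjoint (PosSpace.op A) h with hp
  have hq : ∀ q : PosSpace A, inner ℂ (PosSpace.incl A p) (PosSpace.incl A q) +
      inner ℂ (PosSpace.op A p) (PosSpace.op A q) = inner ℂ h (PosSpace.op A q) := fun q => by
    rw [← inner_posSpace, hp, adjoint_inner_left]
  -- The vector `h - A p` solves the equation `(1 + A²) x = h` that determines `J† h`.
  obtain ⟨x, hx1, hx2⟩ := exists_posSpace_of_inner hA (x := h - PosSpace.op A p)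
    (y := PosSpace.incl A p) fun q => by rw [inner_sub_left, ← hq q, add_sub_cancel_right]
  have : adjoint (PosSpace.incl A) h = x := by
    refine ext_inner_right ℂ fun q => ?_
    rw [adjoint_inner_left, inner_posSpace, hx1, hx2, inner_sub_left, inner_op_left hA,
      sub_add_cancel]
  rw [this, hx2]

lemma opResolv_eq (hA : IsSelfAdjoint A) (h : H) :
    opResolv A h = PosSpace.incl A (adjoint (PosSpace.op A) h) := op_adjoint_incl_eq hA h

lemma resolv_opResolv (hA : IsSelfAdjoint A) (h : H) :
    resolv A (opResolv A h) = opResolv A (resolv A h) := by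
  rw [opResolv_eq hA (resolv A h)]
  change PosSpace.incl A (adjoint (PosSpace.incl A) (opResolv A h)) = _
  congr 1
  refine ext_inner_right ℂ fun q => ?_
  rw [adjoint_inner_left, adjoint_inner_left]
  exact inner_op_left hA _ q

lemma inner_resolv_opResolv_im (hA : IsSelfAdjoint A) (h : H) :
    (inner ℂ (resolv A h) (opResolv A h)).im = 0 := by
  have h1 : inner ℂ (opResolv A h) (resolv A h) = inner ℂ (resolv A h) (opResolv A h) :=
    inner_op_left hA _ _
  rw [← inner_conj_symm] at h1
  exact Complex.conj_eq_iff_im.1 h1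

lemma inner_resolv (h k : H) : inner ℂ h (resolv A k) =
    inner ℂ (PosSpace.incl A (adjoint (PosSpace.incl A) h)) k := by
  change inner ℂ h (PosSpace.incl A (adjoint (PosSpace.incl A) k)) = _
  rw [← adjoint_inner_left, adjoint_inner_right]

lemma inner_opResolv (hA : IsSelfAdjoint A) (h k : H) : inner ℂ h (opResolv A k) =
    inner ℂ (PosSpace.op A (adjoint (PosSpace.incl A) h)) k := by
  rw [opResolv_eq hA, ← adjoint_inner_left, adjoint_inner_right]

lemma resolv_eq_zero (hA : Dense (A.domain : Set H)) {h : H} (h0 : resolv A h = 0) : h = 0 := by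
  have h1 : adjoint (PosSpace.incl A) h = 0 := by
    rw [← inner_self_eq_zero (𝕜 := ℂ), adjoint_inner_left]
    exact (congrArg (inner ℂ h) h0).trans (inner_zero_right _)
  refine hA.eq_zero_of_inner_right ℂ fun g hg => ?_
  change inner ℂ (PosSpace.incl A (PosSpace.ofDomain A ⟨g, hg⟩)) h = 0
  rw [← adjoint_inner_right, h1, inner_zero_right]

end Regularization

/-! ### Regularity and growth of eigenfunctions -/

section WeakEigenfunction

variable {H : Type*} [NormedAddCommGroup H] [InnerProductSpace ℂ H] {A : H →ₗ.[ℂ] H} {I : Set ℝ}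
  {z : ℂ} {u : L2 H I}

variable (A z) in
/-- The equation `i u' + Ã u = z u` on `I`, tested with the functions `χ g`, where `χ` is a scalar
test function on `I` and `g` is a vector of `H₊`. -/
def IsWeakEigenfunction (u : L2 H I) : Prop :=
  ∀ χ : ℝ → ℝ, ContDiff ℝ ∞ χ → HasCompactSupport χ → tsupport χ ⊆ I → ∀ g : PosSpace A,
    ∫ t in I, deriv χ t • inner ℂ (PosSpace.incl A g) (u t) =
      ∫ t in I, χ t • (Complex.I *
        (z * inner ℂ (PosSpace.incl A g) (u t) - inner ℂ (PosSpace.op A g) (u t)))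

lemma locallyIntegrableOn_of_memLp {F : Type*} [NormedAddCommGroup F] {f : ℝ → F}
    (hf : MemLp f 2 (volume.restrict I)) : LocallyIntegrableOn f I volume :=
  locallyIntegrableOn_of_locallyIntegrable_restrict (hf.locallyIntegrable (by norm_num))

variable [CompleteSpace H] [CompleteSpace (PosSpace A)]

/-- After regularization by `(1 + A²)⁻¹` the equation takes place in `H`. -/
lemma IsWeakEigenfunction.hasWeakDeriv (hA : IsSelfAdjoint A) (hu : IsWeakEigenfunction A z u) :
    HasWeakDeriv I (fun t => resolv A (u t))
      (fun t => -(Complex.I • (z • resolv A (u t) - opResolv A (u t)))) := by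
  have h1 : MemLp (fun t => resolv A (u t)) 2 (volume.restrict I) :=
    (resolv A).comp_memLp' (Lp.memLp u)
  have h2 : MemLp (fun t => opResolv A (u t)) 2 (volume.restrict I) :=
    (opResolv A).comp_memLp' (Lp.memLp u)
  have h3 : MemLp (fun t => -(Complex.I • (z • resolv A (u t) - opResolv A (u t)))) 2
      (volume.restrict I) := (((h1.const_smul z).sub h2).const_smul Complex.I).neg
  have l1 := locallyIntegrableOn_of_memLp h1
  have l3 := locallyIntegrableOn_of_memLp h3
  refine ⟨l1, l3, fun χ c1 c2 c3 => ?_⟩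
  have i1 := integrableOn_smul_of_tsupport l1 (c1.continuous_deriv (by simp)) c2.deriv
    (tsupport_deriv_subset.trans c3)
  have i3 := integrableOn_smul_of_tsupport l3 c1.continuous c2 c3
  refine ext_inner_left ℂ fun h => ?_
  rw [inner_neg_right, ← integral_inner i1, ← integral_inner i3, ← integral_neg]
  convert hu χ c1 c2 c3 (ContinuousLinearMap.adjoint (PosSpace.incl A) h) using 1
  · refine integral_congr_ae (Filter.Eventually.of_forall fun t => ?_)
    simp only [inner_smul_right_eq_smul]
    rw [inner_resolv]
  · refine integral_congr_ae (Filter.Eventually.of_forall fun t => ?_)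
    simp only [inner_smul_right_eq_smul, inner_neg_right, inner_sub_right, smul_neg, neg_neg]
    rw [inner_resolv, inner_opResolv hA]
    rfl

/-- The norm of a twice regularized solution of `i y' + A y = z y` is a multiple of
`exp (Im z · t)`, because `A` is symmetric. -/
lemma IsWeakEigenfunction.exists_norm_sq_eq (hA : IsSelfAdjoint A) [I.OrdConnected]
    (hI : IsOpen I) (hne : I.Nonempty) (hu : IsWeakEigenfunction A z u) :
    ∃ C : ℝ, ∀ᵐ t ∂(volume.restrict I),
      ‖resolv A (resolv A (u t))‖ ^ 2 = C * Real.exp (2 * z.im * t) := by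
  obtain ⟨V, hV1, hV2, hV3⟩ := (hu.hasWeakDeriv hA).exists_primitive hI hne
  have hloc := (hu.hasWeakDeriv hA).locInt_deriv
  set y : ℝ → H := fun t => resolv A (V t) with hy
  set y' : ℝ → H := fun t => -(Complex.I • (z • resolv A (V t) - opResolv A (V t))) with hy'
  have hyc : ContinuousOn y' I :=
    ((((resolv A).continuous.comp_continuousOn hV2).const_smul z).sub
      ((opResolv A).continuous.comp_continuousOn hV2)).const_smul Complex.I |>.neg
  have hinc : ∀ s ∈ I, ∀ t ∈ I, y t - y s = ∫ r in s..t, y' r := by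
    intro s hs t ht
    rw [hy, ← map_sub, hV3 s hs t ht, ← ContinuousLinearMap.intervalIntegral_comp_comm _
      (intervalIntegrable_of_locallyIntegrableOn hloc hs ht)]
    refine intervalIntegral.integral_congr_ae ?_
    have := (ae_restrict_iff' hI.measurableSet).1 hV1
    filter_upwards [this] with r hr hrst
    have hrI : r ∈ I := Set.OrdConnected.uIcc_subset ‹_› hs ht (uIoc_subset_uIcc hrst)
    rw [hy', map_neg, map_smul, map_sub, map_smul, resolv_opResolv hA, hr hrI]
  have hd : ∀ t ∈ I, HasDerivAt y (y' t) t := by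
    intro t ht
    have h1 : HasDerivAt (fun s => y t + ∫ r in t..s, y' r) (y' t) t := by
      refine (intervalIntegral.integral_hasDerivAt_right (by simp) ?_
        (hyc.continuousAt (hI.mem_nhds ht))).const_add _
      exact hyc.stronglyMeasurableAtFilter hI t ht
    refine h1.congr_of_eventuallyEq ?_
    filter_upwards [hI.mem_nhds ht] with s hs
    rw [← hinc t ht s hs, add_sub_cancel]
  let e : ℝ → ℝ := fun t => ‖y t‖ ^ 2 * Real.exp (-(2 * z.im * t))
  have he : ∀ t ∈ I, HasDerivAt e 0 t := by
    intro t ht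
    have h1 : HasDerivAt (fun t => ‖y t‖ ^ 2) (2 * z.im * ‖y t‖ ^ 2) t := by
      have h3 : (inner ℂ (y t) (y' t)).re = z.im * ‖y t‖ ^ 2 := by
        have h4 := inner_resolv_opResolv_im hA (V t)
        have h5 : inner ℂ (y t) (y t) = ((‖y t‖ ^ 2 : ℝ) : ℂ) := by
          rw [inner_self_eq_norm_sq_to_K]
          norm_cast
        have h6 : inner ℂ (y t) (y' t) = -(Complex.I *
            (z * ((‖y t‖ ^ 2 : ℝ) : ℂ) - inner ℂ (resolv A (V t)) (opResolv A (V t)))) := by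
          rw [← h5, hy', inner_neg_right, inner_smul_right, inner_sub_right, inner_smul_right]
        rw [h6]
        generalize ‖y t‖ ^ 2 = r
        simp [h4]
      have h2 := Complex.reCLM.hasFDerivAt.comp_hasDerivAt t ((hd t ht).inner ℂ (hd t ht))
      refine (h2.congr_deriv ?_).congr_of_eventuallyEq
        (Filter.Eventually.of_forall fun s => (inner_self_eq_norm_sq (𝕜 := ℂ) (y s)).symm)
      rw [Complex.reCLM_apply, Complex.add_re, ← inner_conj_symm (y' t), Complex.conj_re, h3]
      ring
    have h2 : HasDerivAt (fun t : ℝ => Real.exp (-(2 * z.im * t)))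
        (Real.exp (-(2 * z.im * t)) * (-(2 * z.im))) t := by
      have h3 : HasDerivAt (fun t : ℝ => -(2 * z.im * t)) (-(2 * z.im)) t := by
        simpa using ((hasDerivAt_id t).const_mul (2 * z.im)).fun_neg
      exact h3.exp
    refine (h1.mul h2).congr_deriv ?_
    ring
  obtain ⟨c, hc⟩ := hne
  refine ⟨e c, ?_⟩
  filter_upwards [hV1, ae_restrict_mem hI.measurableSet] with t ht htI
  have hconst : e t = e c := by
    refine hI.is_const_of_deriv_eq_zero (Set.OrdConnected.isPreconnected ‹_›)
      (fun s hs => (he s hs).differentiableAt.differentiableWithinAt)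
      (fun s hs => (he s hs).deriv) htI hc
  rw [← hconst, ht]
  simp only [e]
  rw [mul_assoc, ← Real.exp_add, neg_add_cancel, Real.exp_zero, mul_one]

/-- On a half-line along which `exp (Im z · t)` does not decay, there are no square integrable
solutions. -/
lemma IsWeakEigenfunction.eq_zero_of_growth (hA : IsSelfAdjoint A) [I.OrdConnected]
    (hI : IsOpen I) (hvol : volume I = ⊤) {a : ℝ} (hz : ∀ t ∈ I, 0 ≤ z.im * (t - a))
    (hu : IsWeakEigenfunction A z u) : u = 0 := by
  have hne : I.Nonempty := nonempty_of_measure_ne_zero (hvol ▸ ENNReal.top_ne_zero)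
  obtain ⟨C, hC⟩ := hu.exists_norm_sq_eq hA hI hne
  have hm : MemLp (fun t => resolv A (resolv A (u t))) 2 (volume.restrict I) :=
    (resolv A ∘L resolv A).comp_memLp' (Lp.memLp u)
  have hi : IntegrableOn (fun t => C * Real.exp (2 * z.im * t)) I :=
    hm.integrable_norm_pow (by norm_num) |>.congr hC
  have hC0 : C = 0 := by
    by_contra hC0
    have h1 : IntegrableOn (fun t => Real.exp (2 * z.im * t)) I := by
      refine (hi.const_mul C⁻¹).congr (Filter.Eventually.of_forall fun t => ?_)
      simp only
      rw [inv_mul_cancel_left₀ hC0]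
    have h2 : IntegrableOn (fun _ => Real.exp (2 * z.im * a)) I := by
      refine h1.mono' aestronglyMeasurable_const ?_
      filter_upwards [ae_restrict_mem hI.measurableSet] with t ht
      rw [Real.norm_eq_abs, Real.abs_exp, Real.exp_le_exp]
      linarith [hz t ht]
    rw [integrableOn_const_iff] at h2
    rcases h2 with h | h
    · exact (Real.exp_pos _).ne' (enorm_eq_zero.1 h)
    · exact h.ne hvol
  refine (Lp.eq_zero_iff_ae_eq_zero).2 ?_
  filter_upwards [hC] with t ht
  rw [hC0, zero_mul, sq_eq_zero_iff, norm_eq_zero] at ht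
  exact resolv_eq_zero hA.dense_domain (resolv_eq_zero hA.dense_domain ht)

/-- A solution with boundary value zero vanishes. -/
lemma IsWeakEigenfunction.eq_zero_of_boundaryValue (hA : IsSelfAdjoint A) [I.OrdConnected]
    (hI : IsOpen I) {a : ℝ} (ha : a ∈ closure I) (hb : HasBoundaryValue u a 0)
    (hu : IsWeakEigenfunction A z u) : u = 0 := by
  obtain ⟨C, hC⟩ := hu.exists_norm_sq_eq hA hI (closure_nonempty_iff.1 ⟨a, ha⟩)
  obtain ⟨v, hv1, hv2, hv3⟩ := hb
  have h1 : (fun t => ‖resolv A (resolv A (v t))‖ ^ 2) =ᵐ[volume.restrict I]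
      fun t => C * Real.exp (2 * z.im * t) := by
    filter_upwards [hC, hv2] with t h1 h2
    rw [← h1, h2]
  have h2 : ContinuousOn (fun t => ‖resolv A (resolv A (v t))‖ ^ 2) (closure I) :=
    ((resolv A ∘L resolv A).continuous.comp_continuousOn hv1).norm.pow 2
  have h3 : ContinuousOn (fun t => C * Real.exp (2 * z.im * t)) (closure I) := by fun_prop
  have h4 := (Measure.eqOn_open_of_ae_eq h1 hI (h2.mono subset_closure)
    (h3.mono subset_closure)).of_subset_closure h2 h3 subset_closure subset_rfl ha
  have hC0 : C = 0 := by
    simpa [hv3, Real.exp_ne_zero] using h4.symm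
  refine (Lp.eq_zero_iff_ae_eq_zero).2 ?_
  filter_upwards [hC] with t ht
  rw [hC0, zero_mul, sq_eq_zero_iff, norm_eq_zero] at ht
  exact resolv_eq_zero hA.dense_domain (resolv_eq_zero hA.dense_domain ht)

end WeakEigenfunction

section BoundaryValue

variable {H : Type*} [NormedAddCommGroup H] {I : Set ℝ}

lemma HasBoundaryValue.eq_zero (hI : IsOpen I) {a : ℝ} (ha : a ∈ closure I) {x : H}
    (h : HasBoundaryValue (0 : L2 H I) a x) : x = 0 := by
  obtain ⟨v, hv1, hv2, hv3⟩ := h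
  have h1 : v =ᵐ[volume.restrict I] fun _ => (0 : H) := hv2.symm.trans (coeFn_zero_ae I)
  rw [← hv3]
  exact (Measure.eqOn_open_of_ae_eq h1 hI (hv1.mono subset_closure)
    continuousOn_const).of_subset_closure hv1 continuousOn_const subset_closure subset_rfl ha

end BoundaryValue

/-! ### From operators to the weak equation, and absence of eigenvalues -/

section Eigenfunctions

variable {H : Type*} [NormedAddCommGroup H] [InnerProductSpace ℂ H] {A : H →ₗ.[ℂ] H} {I : Set ℝ}
  {z : ℂ} {u : L2 H I}

lemma NegSpace.eval_smul_real (g : PosSpace A) (r : ℝ) (F : NegSpace A) :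
    NegSpace.eval g (r • F) = r • NegSpace.eval g F :=
  ((NegSpace.eval g).restrictScalars ℝ).map_smul r F

lemma SolvesExpr.isWeakEigenfunction (h : SolvesExpr A I u (z • u)) :
    IsWeakEigenfunction A z u := by
  obtain ⟨u', hu, he⟩ := h
  intro χ c1 c2 c3 g
  have i1 := integrableOn_smul_of_tsupport hu.locInt (c1.continuous_deriv (by simp)) c2.deriv
    (tsupport_deriv_subset.trans c3)
  have i2 := integrableOn_smul_of_tsupport hu.locInt_deriv c1.continuous c2 c3
  have key := congrArg (NegSpace.eval g) (hu.integral_eq χ c1 c2 c3)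
  rw [map_neg, ← ContinuousLinearMap.integral_comp_comm _ i1,
    ← ContinuousLinearMap.integral_comp_comm _ i2, ← integral_neg] at key
  simp only [NegSpace.eval_smul_real, toNeg_apply] at key
  rw [key]
  refine integral_congr_ae ?_
  filter_upwards [he, Lp.coeFn_smul z u] with t h1 h2
  have h3 := congrArg (NegSpace.eval g) h1
  rw [h2, Pi.smul_apply, map_add, map_smul, map_smul, map_smul, toNeg_apply, extOp_apply] at h3
  have h4 : NegSpace.eval g (u' t) = -(Complex.I *
      (z * inner ℂ (PosSpace.incl A g) (u t) - inner ℂ (PosSpace.op A g) (u t))) := by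
    simp only [smul_eq_mul] at h3
    linear_combination (-Complex.I) * h3 + NegSpace.eval g (u' t) * Complex.I_mul_I
  simp only [h4, smul_neg, neg_neg]

lemma mem_graph_minimal_of_test (hA : Dense (A.domain : Set H)) (hI : IsOpen I)
    {v w : L2 H I} (hv : v ∈ testSpace A I) (hw : (v, w) ∈ maxGraph A I) :
    (v, w) ∈ (minimal A I).graph := by
  refine LinearPMap.le_graph_of_le (LinearPMap.le_closure _) ?_
  rw [← maximal_graph hA hI] at hw
  obtain ⟨x, hx1, hx2⟩ := (LinearPMap.mem_graph_iff _).1 hw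
  have hx1 : (x : L2 H I) = v := hx1
  have hx : (x : L2 H I) ∈ ((maximal A I).domRestrict (testSpace A I)).domain :=
    ⟨hx1 ▸ hv, x.2⟩
  exact (LinearPMap.mem_graph_iff _).2 ⟨⟨x, hx⟩, hx1, hx2⟩

/-- A vector on which the adjoint of the minimal operator acts as the multiplication by `z`
satisfies the weak equation. -/
lemma isWeakEigenfunction_of_inner_minimal [CompleteSpace H] (hA : IsSelfAdjoint A) (hI : IsOpen I)
    (h : ∀ φ : (minimal A I).domain, inner ℂ (minimal A I φ) u = inner ℂ (φ : L2 H I) (z • u)) :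
    IsWeakEigenfunction A z u := by
  intro χ c1 c2 c3 g
  have hsymm := isFormalAdjoint_self hA
  let φ : ℝ → PosSpace A := fun t => χ t • g
  have hφ1 : ContDiff ℝ ∞ φ := c1.smul contDiff_const
  have hφ2 : HasCompactSupport φ := c2.smul_right
  have hφ3 : tsupport φ ⊆ I := (tsupport_smul_subset_left χ fun _ => g).trans c3
  have hφd : ∀ t, deriv φ t = deriv χ t • g := fun t =>
    ((c1.differentiable (by simp) t).hasDerivAt.smul_const g).deriv
  have hm : MemLp (fun t => PosSpace.incl A (φ t)) 2 (volume.restrict I) :=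
    (((PosSpace.incl A).continuous.comp hφ1.continuous).memLp_of_hasCompactSupport
      (hφ2.comp_left (g := PosSpace.incl A) (map_zero _))).restrict I
  obtain ⟨w, hw1, hw2⟩ := exists_maximal_of_test hsymm hφ1 hφ2 hm.coeFn_toLp
  obtain ⟨x, hx1, hx2⟩ := (LinearPMap.mem_graph_iff _).1
    (mem_graph_minimal_of_test hA.dense_domain hI ⟨φ, hφ1, hφ2, hφ3, hm.coeFn_toLp⟩ hw1)
  have key := h x
  rw [hx1, hx2, L2.inner_def, L2.inner_def] at key
  have hloc : ∀ f : H, LocallyIntegrableOn (fun t => inner ℂ f (u t)) I volume := fun f =>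
    locallyIntegrableOn_of_memLp ((innerSL ℂ f).comp_memLp' (Lp.memLp u))
  have i1 := integrableOn_smul_of_tsupport (hloc (PosSpace.incl A g))
    (c1.continuous_deriv (by simp)) c2.deriv (tsupport_deriv_subset.trans c3)
  have i2 := integrableOn_smul_of_tsupport (hloc (PosSpace.incl A g)) c1.continuous c2 c3
  have i3 := integrableOn_smul_of_tsupport (hloc (PosSpace.op A g)) c1.continuous c2 c3
  have real_smul : ∀ (L : PosSpace A →L[ℂ] H) (r : ℝ), L (r • g) = (r : ℂ) • L g := fun L r =>
    L.map_smul (r : ℂ) g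
  have e1 : ∫ t in I, inner ℂ (w t) (u t) =
      -Complex.I * (∫ t in I, deriv χ t • inner ℂ (PosSpace.incl A g) (u t)) +
        ∫ t in I, χ t • inner ℂ (PosSpace.op A g) (u t) := by
    rw [← integral_const_mul, ← integral_add (i1.const_mul _) i3]
    refine integral_congr_ae ?_
    filter_upwards [hw2] with t ht
    rw [ht, hφd, real_smul, real_smul, inner_add_left, inner_smul_left, inner_smul_left,
      inner_smul_left, Complex.conj_I, Complex.conj_ofReal, Complex.conj_ofReal, Complex.real_smul,
      Complex.real_smul]
  have e2 : ∫ t in I, inner ℂ ((hm.toLp _ : L2 H I) t) ((z • u : L2 H I) t) =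
      z * ∫ t in I, χ t • inner ℂ (PosSpace.incl A g) (u t) := by
    rw [← integral_const_mul]
    refine integral_congr_ae ?_
    filter_upwards [hm.coeFn_toLp, Lp.coeFn_smul z u] with t h1 h2
    rw [h1, h2, real_smul, Pi.smul_apply, inner_smul_left, inner_smul_right, Complex.conj_ofReal,
      Complex.real_smul]
    ring
  have e3 : ∫ t in I, χ t • (Complex.I *
        (z * inner ℂ (PosSpace.incl A g) (u t) - inner ℂ (PosSpace.op A g) (u t))) =
      Complex.I * (z * (∫ t in I, χ t • inner ℂ (PosSpace.incl A g) (u t)) -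
        ∫ t in I, χ t • inner ℂ (PosSpace.op A g) (u t)) := by
    rw [← integral_const_mul, ← integral_sub (i2.const_mul z) i3, ← integral_const_mul]
    refine integral_congr_ae (Filter.Eventually.of_forall fun t => ?_)
    simp only [Complex.real_smul]
    ring
  rw [e3, ← e2, ← key, e1]
  linear_combination (∫ t in I, deriv χ t • inner ℂ (PosSpace.incl A g) (u t)) * Complex.I_mul_I

end Eigenfunctions

section PointSpectrum

variable {H : Type*} [NormedAddCommGroup H] [InnerProductSpace ℂ H] [CompleteSpace H]
  {a₁ a₃ : ℝ} {A A₁ A₃ : H →ₗ.[ℂ] H} {z : ℂ}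

lemma eq_zero_on_Iio (hA : IsSelfAdjoint A) {a : ℝ} (hz : z.im ≤ 0) {u : L2 H (Iio a)}
    (hu : IsWeakEigenfunction A z u) : u = 0 := by
  have := completeSpace_posSpace hA.isClosed
  exact hu.eq_zero_of_growth hA isOpen_Iio Real.volume_Iio
    fun t ht => mul_nonneg_of_nonpos_of_nonpos hz (sub_nonpos.2 (le_of_lt ht))

lemma eq_zero_on_Ioi (hA : IsSelfAdjoint A) {a : ℝ} (hz : 0 ≤ z.im) {u : L2 H (Ioi a)}
    (hu : IsWeakEigenfunction A z u) : u = 0 := by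
  have := completeSpace_posSpace hA.isClosed
  exact hu.eq_zero_of_growth hA isOpen_Ioi Real.volume_Ioi
    fun t ht => mul_nonneg hz (sub_nonneg.2 (le_of_lt ht))

/-- A selfadjoint extension is a restriction of the adjoint of the minimal operator and has real
eigenvalues only, so that the norms of the components of an eigenfunction are constant. -/
theorem pointSpectrum_eq_empty_of_minimalSum_le (hA₁ : IsSelfAdjoint A₁) (hA₃ : IsSelfAdjoint A₃)
    {S : L2Sum H a₁ a₃ →ₗ.[ℂ] L2Sum H a₁ a₃} (hS : IsSelfAdjoint S)
    (hle : minimalSum A₁ A₃ a₁ a₃ ≤ S) : pointSpectrum S = ∅ := by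
  refine eq_empty_of_forall_notMem ?_
  rintro z ⟨u, hu0, hu⟩
  have hsymm : ∀ x y : S.domain, inner ℂ (S x) (y : L2Sum H a₁ a₃) =
      inner ℂ (x : L2Sum H a₁ a₃) (S y) := isFormalAdjoint_self hS
  have hz : z.im = 0 := by
    have h1 := hsymm u u
    rw [hu, inner_smul_left, inner_smul_right] at h1
    exact Complex.conj_eq_iff_im.1 (mul_right_cancel₀ (inner_self_ne_zero.2 hu0) h1)
  have key : ∀ x : (minimalSum A₁ A₃ a₁ a₃).domain,
      inner ℂ (minimalSum A₁ A₃ a₁ a₃ x) (u : L2Sum H a₁ a₃) =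
        inner ℂ (x : L2Sum H a₁ a₃) (z • (u : L2Sum H a₁ a₃)) := by
    intro x
    rw [← hu, ← hsymm ⟨x, hle.1 x.2⟩ u]
    exact congrArg (inner ℂ · _) (hle.2 rfl)
  have h1 : IsWeakEigenfunction A₁ z (u : L2Sum H a₁ a₃).fst := by
    refine isWeakEigenfunction_of_inner_minimal hA₁ isOpen_Iio fun φ => ?_
    have h := key ⟨WithLp.toLp 2 ((φ : L2 H (Iio a₁)), 0), φ.2, Submodule.zero_mem _⟩
    have h0 : minimalSum A₁ A₃ a₁ a₃
        ⟨WithLp.toLp 2 ((φ : L2 H (Iio a₁)), 0), φ.2, Submodule.zero_mem _⟩ =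
        WithLp.toLp 2 (minimal A₁ (Iio a₁) φ, minimal A₃ (Ioi a₃) 0) := rfl
    rw [h0, LinearPMap.map_zero, WithLp.prod_inner_apply, WithLp.prod_inner_apply] at h
    simpa using h
  have h3 : IsWeakEigenfunction A₃ z (u : L2Sum H a₁ a₃).snd := by
    refine isWeakEigenfunction_of_inner_minimal hA₃ isOpen_Ioi fun φ => ?_
    have h := key ⟨WithLp.toLp 2 (0, (φ : L2 H (Ioi a₃))), Submodule.zero_mem _, φ.2⟩
    have h0 : minimalSum A₁ A₃ a₁ a₃
        ⟨WithLp.toLp 2 (0, (φ : L2 H (Ioi a₃))), Submodule.zero_mem _, φ.2⟩ =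
        WithLp.toLp 2 (minimal A₁ (Iio a₁) 0, minimal A₃ (Ioi a₃) φ) := rfl
    rw [h0, LinearPMap.map_zero, WithLp.prod_inner_apply, WithLp.prod_inner_apply] at h
    simpa using h
  refine hu0 (WithLp.ofLp_injective 2 (Prod.ext ?_ ?_))
  · exact eq_zero_on_Iio hA₁ hz.le h1
  · exact eq_zero_on_Ioi hA₃ hz.ge h3

/-- The eigenvalue `z` need not be known to be real: the sign of `Im z` decides which component
vanishes because it would not decay, and the boundary condition takes care of the other one. -/
theorem pointSpectrum_extension_eq_empty (hA₁ : IsSelfAdjoint A₁) (hA₃ : IsSelfAdjoint A₃)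
    (W : H ≃ₗᵢ[ℂ] H) : pointSpectrum (extension A₁ A₃ a₁ a₃ W) = ∅ := by
  refine eq_empty_of_forall_notMem ?_
  rintro z ⟨⟨u, ⟨x, hx1, hx3⟩, hu1, hu3⟩, hu0, hu⟩
  have hu : WithLp.toLp 2 (maximal A₁ (Iio a₁) ⟨u.fst, hu1⟩, maximal A₃ (Ioi a₃) ⟨u.snd, hu3⟩) =
    z • u := hu
  have h1 : IsWeakEigenfunction A₁ z u.fst := by
    refine SolvesExpr.isWeakEigenfunction ?_
    have h := (maximal A₁ (Iio a₁)).mem_graph ⟨u.fst, hu1⟩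
    rw [maximal_graph hA₁.dense_domain isOpen_Iio] at h
    have e : maximal A₁ (Iio a₁) ⟨u.fst, hu1⟩ = z • u.fst := congrArg WithLp.fst hu
    rw [e] at h
    exact h
  have h3 : IsWeakEigenfunction A₃ z u.snd := by
    refine SolvesExpr.isWeakEigenfunction ?_
    have h := (maximal A₃ (Ioi a₃)).mem_graph ⟨u.snd, hu3⟩
    rw [maximal_graph hA₃.dense_domain isOpen_Ioi] at h
    have e : maximal A₃ (Ioi a₃) ⟨u.snd, hu3⟩ = z • u.snd := congrArg WithLp.snd hu
    rw [e] at h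
    exact h
  have m1 : a₁ ∈ closure (Iio a₁) := by simp
  have m3 : a₃ ∈ closure (Ioi a₃) := by simp
  have c1 := completeSpace_posSpace hA₁.isClosed
  have c3 := completeSpace_posSpace hA₃.isClosed
  -- One component vanishes by growth; the boundary condition then gives the other one the
  -- boundary value zero.
  refine hu0 (WithLp.ofLp_injective 2 ?_)
  rcases le_total z.im 0 with hz | hz
  · have e1 := eq_zero_on_Iio hA₁ hz h1
    have hx : x = 0 := by
      rw [e1] at hx1
      exact hx1.eq_zero isOpen_Iio m1
    rw [hx, map_zero] at hx3
    exact Prod.ext e1 (h3.eq_zero_of_boundaryValue hA₃ isOpen_Ioi m3 hx3)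
  · have e3 := eq_zero_on_Ioi hA₃ hz h3
    have hx : W x = 0 := by
      rw [e3] at hx3
      exact hx3.eq_zero isOpen_Ioi m3
    rw [W.map_eq_zero_iff] at hx
    rw [hx] at hx1
    exact Prod.ext (h1.eq_zero_of_boundaryValue hA₁ isOpen_Iio m1 hx1) e3

end PointSpectrum

end MultipointOperator

end

theorem theorem3p1 {H : Type*} [NormedAddCommGroup H] [InnerProductSpace ℂ H] [CompleteSpace H]
    [TopologicalSpace.SeparableSpace H] (a₁ a₃ : ℝ) (ha : a₁ < a₃) (A₁ A₃ : H →ₗ.[ℂ] H)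
    (hA₁ : IsSelfAdjoint A₁) (hA₃ : IsSelfAdjoint A₃) :
    (∀ S : MultipointOperator.L2Sum H a₁ a₃ →ₗ.[ℂ] MultipointOperator.L2Sum H a₁ a₃, IsSelfAdjoint S →
      MultipointOperator.minimalSum A₁ A₃ a₁ a₃ ≤ S → MultipointOperator.pointSpectrum S = ∅) ∧
    (∀ W₁ : H ≃ₗᵢ[ℂ] H, MultipointOperator.pointSpectrum (MultipointOperator.extension A₁ A₃ a₁ a₃ W₁) = ∅) := by
  exact ⟨fun S hS hle => MultipointOperator.pointSpectrum_eq_empty_of_minimalSum_le hA₁ hA₃ hS hle,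
    fun W => MultipointOperator.pointSpectrum_extension_eq_empty hA₁ hA₃ W⟩
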